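/- Let $p$ be an odd prime, let $f=\exp\left(x+\frac{x^p}{p}\right)\in\mathbb{Q}_p[[x]]$ be the Dwork exponential, and for a formal Laurent series $g=\sum_{n\in\mathbb{Z}}a_nx^n$ over $\mathbb{Q}_p$ put $[g]_0=a_0$ and $$D_x\,g=\sum_{i\ge 0}\partial_x^i\,(x^{-1}g),$$ the sum being taken coefficientwise in the $p$-adic topology. Let $\omega$ be the Teichmüller character, $\langle n\rangle=n/\omega(n)$, and let $$L_p(s,\chi)=\frac{1}{s-1}\lim_{k\to\infty}\frac{1}{p^{k+1}}\sum_{\substack{1\le n\le p^{k+1}\\ p\nmid n}}\chi(n)\langle n\rangle^{1-s}$$ be the Kubota–Leopoldt $p$-adic $L$-function ($s\in\mathbb{Z}_p$, $s\neq 1$, $\chi$ a power of $\omega$). For integers $s\ge 2$ denote by $\zeta_p(s)=\frac{p^s}{p^s-1}L_p(s,\omega^{1-s})$ the $p$-adic zeta values. Then all the series defining the iterates $D_x^sf$ ($s\ge 1$) converge, the limit defining $L_p(3,\omega^{-2})$ exists, and $$\Delta_3:=[D_x^3f]_0-\frac{[D_xf]_0^3}{3!}=\frac{L_p(3,\omega^{-2})}{3}=\left(1-\frac1{p^3}\right)\frac{\zeta_p(3)}{3}.$$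 Consequently $$p^3\,\frac{24}{25}\,\Delta_3=p^3\,\frac{2^3}{5^2}\,L_p(3,\omega^{-2})=(p^3-1)\,\frac{2^3}{5^2}\,\zeta_p(3).$$ -/

import Mathlib

open Filter Topology

noncomputable section

namespace DworkGamma

/-! ### Laurent series, the operator `D_x`, and the Dwork exponential -/

/-- A formal two-sided Laurent series `∑_{n ∈ ℤ} a_n x^n` over `ℚ_p`, given by its coefficients. -/
abbrev Laurent (p : ℕ) [Fact p.Prime] : Type := ℤ → ℚ_[p]

/-- A power series, seen as a Laurent series without negative powers of `x`. -/
def ofPowerSeries {p : ℕ} [Fact p.Prime] (g : PowerSeries ℚ_[p]) : Laurent p :=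
  fun n => if 0 ≤ n then PowerSeries.coeff n.toNat g else 0

/-- The formal derivative `∂_x`. -/
def pderiv {p : ℕ} [Fact p.Prime] (a : Laurent p) : Laurent p :=
  fun n => ((n + 1 : ℤ) : ℚ_[p]) * a (n + 1)

/-- Multiplication by `x⁻¹`. -/
def divX {p : ℕ} [Fact p.Prime] (a : Laurent p) : Laurent p :=
  fun n => a (n + 1)

/-- The differential operator of infinite order `∑_{i ≥ 0} ∂_x^i`; the sum is taken coefficientwise,
in the `p`-adic topology. -/
def derivSum {p : ℕ} [Fact p.Prime] (a : Laurent p) : Laurent p :=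
  fun n => ∑' i : ℕ, (pderiv^[i] a) n

/-- The operator `D_x = (∑_{i ≥ 0} ∂_x^i) ∘ x⁻¹`, so that for instance `[D_x x^k]_0 = (k - 1)!`
for `k ≥ 1`. -/
def Dx {p : ℕ} [Fact p.Prime] (a : Laurent p) : Laurent p :=
  derivSum (divX a)

/-- `[g]_0`, the coefficient of `x^0`. -/
def constTerm {p : ℕ} [Fact p.Prime] (a : Laurent p) : ℚ_[p] := a 0

/-- The Dwork exponential `f = exp (x + x^p / p)`. -/
def dworkExp (p : ℕ) [Fact p.Prime] : PowerSeries ℚ_[p] :=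
  (PowerSeries.exp ℚ_[p]).subst
    (PowerSeries.X + PowerSeries.C ((p : ℚ_[p])⁻¹) * PowerSeries.X ^ p : PowerSeries ℚ_[p])

/-- `D_x^s f` for the Dwork exponential `f`. -/
def DxPowDwork (p : ℕ) [Fact p.Prime] (s : ℕ) : Laurent p :=
  Dx^[s] (ofPowerSeries (dworkExp p))

/-- `Δ_s = [D_x^s f]_0 - [D_x f]_0^s / s!`. -/
def Delta (p : ℕ) [Fact p.Prime] (s : ℕ) : ℚ_[p] :=
  constTerm (DxPowDwork p s) - constTerm (DxPowDwork p 1) ^ s / (s.factorial : ℚ_[p])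

/-! ### The Teichmüller character and the Kubota–Leopoldt `p`-adic `L`-function -/

/-- The Teichmüller character `ω`, as a Dirichlet character modulo `p` with values in `ℤ_p`:
`ω(a)` is the Teichmüller representative of `a` under the identification of the Witt vectors of
`𝔽_p` with `ℤ_p`. -/
def teichmullerChar (p : ℕ) [Fact p.Prime] : DirichletCharacter ℤ_[p] p where
  toFun a := WittVector.equiv p (WittVector.teichmuller p a)
  map_one' := by simp
  map_mul' a b := by simp
  map_nonunit' a ha := by
    have h : a = 0 := by
      by_contra h
      exact ha (isUnit_iff_ne_zero.mpr h)
    simp [h]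

/-- `⟨n⟩ = n / ω(n) ∈ 1 + p ℤ_p`, for an integer `n` prime to `p`. -/
def angle (p : ℕ) [Fact p.Prime] (n : ℕ) : ℤ_[p] :=
  (n : ℤ_[p]) * (teichmullerChar p)⁻¹ (n : ZMod p)

/-- `u ^ t = ∑_k binom(t, k) (u - 1)^k` for `u ∈ 1 + p ℤ_p` and `t ∈ ℤ_p`. -/
def unitPow {p : ℕ} [Fact p.Prime] (u t : ℤ_[p]) : ℤ_[p] :=
  PadicInt.mahlerSeries (fun k : ℕ => (u - 1) ^ k) t

/-- The `k`-th approximation `p^{-(k+1)} ∑_{1 ≤ n ≤ p^{k+1}, p ∤ n} χ(n) ⟨n⟩^{1-s}` to the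
Volkenborn integral of `χ(t) ⟨t⟩^{1-s}` over `ℤ_p^×`. -/
def volkenbornSum (p : ℕ) [Fact p.Prime] (s : ℤ_[p]) (χ : DirichletCharacter ℤ_[p] p) (k : ℕ) :
    ℚ_[p] :=
  ((p : ℚ_[p]) ^ (k + 1))⁻¹ *
    ∑ n ∈ (Finset.Icc 1 (p ^ (k + 1))).filter (fun n => ¬ p ∣ n),
      ((χ (n : ZMod p) * unitPow (angle p n) (1 - s) : ℤ_[p]) : ℚ_[p])

/-- The Kubota–Leopoldt `p`-adic `L`-function
`L_p(s, χ) = (s - 1)⁻¹ lim_k p^{-(k+1)} ∑_{1 ≤ n ≤ p^{k+1}, p ∤ n} χ(n) ⟨n⟩^{1-s}`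
for `s ∈ ℤ_p`, `s ≠ 1`, and a Dirichlet character `χ` modulo `p` (a power of `ω`). -/
def kubotaLeopoldt (p : ℕ) [Fact p.Prime] (s : ℤ_[p]) (χ : DirichletCharacter ℤ_[p] p) : ℚ_[p] :=
  ((s : ℚ_[p]) - 1)⁻¹ * limUnder atTop (volkenbornSum p s χ)

/-- The `p`-adic zeta value `ζ_p(s)`, `s ≥ 2`: the value `L_p(s, ω^{1-s})` with the Euler factor
`1 - p^{-s}` restored, `ζ_p(s) = p^s / (p^s - 1) * L_p(s, ω^{1-s})`. -/
def padicZeta (p : ℕ) [Fact p.Prime] (s : ℕ) : ℚ_[p] :=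
  (p : ℚ_[p]) ^ s / ((p : ℚ_[p]) ^ s - 1) *
    kubotaLeopoldt p (s : ℤ_[p]) (teichmullerChar p ^ (1 - (s : ℤ)))

end DworkGamma

end

open Filter Topology

namespace DworkGamma

variable {p : ℕ} [Fact p.Prime]

/-! Encode a series by b(n) = n! a_n. Then D_x becomes the tail operator (Tb)(n) = ∑_{m>n} b(m)/m,
and A_N(b) = ∑ (-1)^n binom(N,n) b(n) satisfies A_N(b) = b(0) - N A_N(Tb) (`Rapid.altSum_eq`). For
the Dwork exponential, with A_N = A_N(b) and g_s = [D_x^s f]_0, iteration gives A_N = 1 - g₁N + g₂N²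
- N³ A_N(T³b), where A_N(T³b) → g₃ as N → 0 p-adically. Convergence rests on b decreasing faster
than every power of n (`rapid_dworkSeq`).

On the other hand A_N = N! [x^N] e^x f(-x), and e^x f(-x) = exp(-x^p/p) for odd p. So for p ∣ N, A_N
is up to sign the product of the j < N prime to p, a value of the p-adic Gamma function
(`altSum_dworkSeq_mul`). Pairing j with N - j gives A_{2N}²/A_N⁴ = 1 - 2N² S(N) + O(N⁴), where S(N)
= ∑ j⁻² over the same j (`norm_altSum_two_mul_sub_le`).

Comparing both descriptions, S(N) → g₁² - 2g₂. As S(2N) ≡ 2S(N) mod N, this limit is 0, and the next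
order yields S(N)/N → 6Δ₃. For N = p^(k+1), S(N)/N is exactly the sum defining L_p(3, ω⁻²), since
ω(n)⁻²⟨n⟩⁻² = n⁻²; the factor 1/(s-1) = 1/2 then gives L_p(3, ω⁻²) = 3Δ₃. -/

/-! ### Alternating binomial sums -/

/-- The alternating binomial transform `∑ (-1)^n binom(N, n) u(n)`. -/
def altSum {K : Type*} [CommRing K] (N : ℕ) (u : ℕ → K) : K :=
  ∑ n ∈ Finset.range (N + 1), (-1) ^ n * (N.choose n : K) * u n

theorem altSum_succ {K : Type*} [CommRing K] (N : ℕ) (t : ℕ → K) :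
    altSum (N + 1) t =
      ∑ n ∈ Finset.range (N + 1), (-1) ^ n * (N.choose n : K) * (t n - t (n + 1)) := by
  have h : ∑ n ∈ Finset.range (N + 1), (-1) ^ n * (N.choose n : K) * t n =
      ∑ n ∈ Finset.range (N + 1), (-1) ^ (n + 1) * (N.choose (n + 1) : K) * t (n + 1) + t 0 := by
    have := Finset.sum_range_succ' (fun n => (-1) ^ n * (N.choose n : K) * t n) (N + 1)
    rw [Finset.sum_range_succ] at this
    simpa using this
  rw [altSum, Finset.sum_range_succ']
  simp only [mul_sub, Finset.sum_sub_distrib, h, Nat.choose_succ_succ, Nat.cast_add]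
  simp only [mul_add, add_mul, Finset.sum_add_distrib, pow_succ]
  simp
  ring

/-- Summation by parts: Pascal's rule turns the transform of t into one of its differences, and the
absorption identity (M+1) binom(M,n) = (n+1) binom(M+1,n+1) trades the factor n+1 for N. It is
applied with t the tail sums of b. -/
theorem altSum_eq_sub {K : Type*} [CommRing K] (N : ℕ) (b t : ℕ → K)
    (h : ∀ n : ℕ, ((n : K) + 1) * (t n - t (n + 1)) = b (n + 1)) :
    altSum N b = b 0 - N * altSum N t := by
  cases N with
  | zero => simp [altSum]
  | succ M =>
    rw [altSum_succ M t, altSum, Finset.sum_range_succ', Finset.mul_sum]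
    have key : ∀ n : ℕ, (-1) ^ (n + 1) * ((M + 1).choose (n + 1) : K) * b (n + 1) =
        -(((M + 1 : ℕ) : K) * ((-1) ^ n * (M.choose n : K) * (t n - t (n + 1)))) := by
      intro n
      have hc : ((M + 1 : ℕ) : K) * (M.choose n : K) =
          ((M + 1).choose (n + 1) : K) * ((n : K) + 1) := by
        exact_mod_cast congrArg (Nat.cast (R := K)) (Nat.add_one_mul_choose_eq M n)
      rw [← h n, pow_succ]
      linear_combination (-1) ^ n * (t n - t (n + 1)) * hc
    simp only [key, Finset.sum_neg_distrib]
    simp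
    ring

theorem norm_altSum_le (N : ℕ) (u : ℕ → ℚ_[p]) {C : ℝ} (hC : 0 ≤ C) (h : ∀ n, ‖u n‖ ≤ C) :
    ‖altSum N u‖ ≤ C := by
  refine IsUltrametricDist.norm_sum_le_of_forall_le_of_nonneg hC fun n _ => ?_
  have h1 : ‖(N.choose n : ℚ_[p])‖ ≤ 1 := by
    simpa using Padic.norm_int_le_one (p := p) (N.choose n : ℤ)
  rw [norm_mul, norm_mul, norm_pow, norm_neg, norm_one, one_pow, one_mul]
  exact (mul_le_of_le_one_left (norm_nonneg _) h1).trans (h n)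

/-! ### Rapidly decreasing sequences and tail sums -/

/-- Sequences decreasing faster than every power of the index. -/
def Rapid (b : ℕ → ℚ_[p]) : Prop := ∀ k : ℕ, ∃ C : ℝ, ∀ n : ℕ, (n : ℝ) ^ k * ‖b n‖ ≤ C

/-- The tail sums `∑_{m > n} b(m) / m`. -/
noncomputable def tailSum (b : ℕ → ℚ_[p]) (n : ℕ) : ℚ_[p] :=
  ∑' i : ℕ, b (n + i + 1) / ((n + i + 1 : ℕ) : ℚ_[p])

/-- The power of p dividing m is at most m, so dividing by m costs at most one power of the index.
This is why rapid decrease survives the tail operator. -/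
theorem norm_div_natCast_le (x : ℚ_[p]) {m : ℕ} (hm : m ≠ 0) :
    ‖x / (m : ℚ_[p])‖ ≤ m * ‖x‖ := by
  have hp := (Fact.out : p.Prime)
  have h : (m : ℝ)⁻¹ ≤ ‖(m : ℚ_[p])‖ := by
    rw [Padic.norm_eq_zpow_neg_valuation (by exact_mod_cast hm), zpow_neg, Padic.valuation_natCast,
      zpow_natCast]
    have hpos : 0 < p ^ padicValNat p m := pow_pos hp.pos _
    refine inv_anti₀ (by exact_mod_cast hpos) ?_
    exact_mod_cast Nat.le_of_dvd (Nat.pos_of_ne_zero hm) pow_padicValNat_dvd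
  rw [norm_div, div_eq_mul_inv, mul_comm]
  have hm' : (0 : ℝ) < m := by exact_mod_cast Nat.pos_of_ne_zero hm
  refine mul_le_mul_of_nonneg_right ?_ (norm_nonneg _)
  calc ‖(m : ℚ_[p])‖⁻¹ ≤ ((m : ℝ)⁻¹)⁻¹ := inv_anti₀ (by positivity) h
    _ = m := inv_inv _

theorem Rapid.summable_div {b : ℕ → ℚ_[p]} (hb : Rapid b) (n : ℕ) :
    Summable fun i : ℕ => b (n + i + 1) / ((n + i + 1 : ℕ) : ℚ_[p]) := by
  apply NonarchimedeanAddGroup.summable_of_tendsto_cofinite_zero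
  rw [Nat.cofinite_eq_atTop]
  obtain ⟨C, hC⟩ := hb 2
  have hlim : Tendsto (fun i : ℕ => C / ((n + i + 1 : ℕ) : ℝ)) atTop (𝓝 0) := by
    refine Tendsto.const_div_atTop (tendsto_natCast_atTop_atTop.comp ?_) _
    exact tendsto_atTop_mono (fun i => by simp only [id]; omega) tendsto_id
  refine squeeze_zero_norm (fun i => ?_) hlim
  have hpos : (0 : ℝ) < ((n + i + 1 : ℕ) : ℝ) := by positivity
  refine (norm_div_natCast_le _ (by omega)).trans ?_
  rw [le_div_iff₀ hpos]
  have := hC (n + i + 1)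
  linarith [this, show ((n + i + 1 : ℕ) : ℝ) ^ 2 * ‖b (n + i + 1)‖ =
    ((n + i + 1 : ℕ) : ℝ) * ‖b (n + i + 1)‖ * ((n + i + 1 : ℕ) : ℝ) by ring]

theorem Rapid.tailSum {b : ℕ → ℚ_[p]} (hb : Rapid b) : Rapid (tailSum b) := by
  intro k
  obtain ⟨C, hC⟩ := hb (k + 1)
  refine ⟨C, fun n => ?_⟩
  have hC0 : 0 ≤ C := le_trans (by positivity) (hC 0)
  -- At n = 0 the weight n^k is 0 or, for k = 0, equal to 1, so it cannot be divided out.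
  rcases Nat.eq_zero_or_pos n with rfl | hn
  · rcases Nat.eq_zero_or_pos k with rfl | hk
    · simp only [pow_zero, one_mul]
      refine IsUltrametricDist.norm_tsum_le_of_forall_le_of_nonneg hC0 fun i => ?_
      refine (norm_div_natCast_le _ (by omega)).trans ?_
      simpa using hC (0 + i + 1)
    · simpa [hk.ne'] using hC0
  · have hnk : (0 : ℝ) < (n : ℝ) ^ k := by positivity
    rw [mul_comm, ← le_div_iff₀ hnk]
    refine IsUltrametricDist.norm_tsum_le_of_forall_le_of_nonneg (by positivity) fun i => ?_
    refine (norm_div_natCast_le _ (by omega)).trans ?_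
    rw [le_div_iff₀ hnk]
    refine le_trans ?_ (hC (n + i + 1))
    have h2 : (n : ℝ) ^ k ≤ ((n + i + 1 : ℕ) : ℝ) ^ k := by
      gcongr; omega
    calc _ ≤ ((n + i + 1 : ℕ) : ℝ) * ‖b (n + i + 1)‖ * ((n + i + 1 : ℕ) : ℝ) ^ k := by gcongr
      _ = _ := by ring

theorem Rapid.tailSum_sub {b : ℕ → ℚ_[p]} (hb : Rapid b) (n : ℕ) :
    ((n : ℚ_[p]) + 1) * (DworkGamma.tailSum b n - DworkGamma.tailSum b (n + 1)) = b (n + 1) := by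
  have h := (hb.summable_div n).tsum_eq_zero_add
  have hn : ((n : ℚ_[p]) + 1) ≠ 0 := by exact_mod_cast Nat.succ_ne_zero n
  have h2 : DworkGamma.tailSum b n = b (n + 1) / ((n : ℚ_[p]) + 1) +
      DworkGamma.tailSum b (n + 1) := by
    rw [DworkGamma.tailSum, h, DworkGamma.tailSum]
    congr 1
    · simp
    · refine tsum_congr fun i => ?_
      rw [show n + (i + 1) + 1 = n + 1 + i + 1 by ring]
  rw [h2]
  field_simp
  ring

theorem Rapid.bounded {b : ℕ → ℚ_[p]} (hb : Rapid b) : ∃ C : ℝ, 0 ≤ C ∧ ∀ n, ‖b n‖ ≤ C := by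
  obtain ⟨C, hC⟩ := hb 0
  exact ⟨C, le_trans (by positivity) (hC 0), fun n => by simpa using hC n⟩

theorem Rapid.altSum_eq {b : ℕ → ℚ_[p]} (hb : Rapid b) (N : ℕ) :
    altSum N b = b 0 - N * altSum N (DworkGamma.tailSum b) :=
  altSum_eq_sub N b _ hb.tailSum_sub

theorem Rapid.tendsto_altSum {b : ℕ → ℚ_[p]} (hb : Rapid b) {N : ℕ → ℕ}
    (hN : Tendsto (fun k => (N k : ℚ_[p])) atTop (𝓝 0)) :
    Tendsto (fun k => altSum (N k) b) atTop (𝓝 (b 0)) := by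
  obtain ⟨C, hC0, hC⟩ := hb.tailSum.bounded
  have h : Tendsto (fun k => (N k : ℚ_[p]) * altSum (N k) (DworkGamma.tailSum b)) atTop (𝓝 0) := by
    have h0 : Tendsto (fun k => ‖(N k : ℚ_[p])‖ * C) atTop (𝓝 0) := by
      simpa using hN.norm.mul_const C
    refine squeeze_zero_norm (fun k => ?_) h0
    rw [norm_mul]
    exact mul_le_mul_of_nonneg_left (norm_altSum_le _ _ hC0 hC) (norm_nonneg _)
  simpa [hb.altSum_eq] using (tendsto_const_nhds (x := b 0)).sub h

/-! ### The operator `D_x` on coefficients -/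

theorem iterate_pderiv_apply (i : ℕ) (a : Laurent p) (n : ℤ) :
    (pderiv^[i] a) n = (∏ j ∈ Finset.range i, ((n + 1 + j : ℤ) : ℚ_[p])) * a (n + i) := by
  induction i generalizing n with
  | zero => simp
  | succ i ih =>
    rw [Function.iterate_succ_apply', pderiv, ih, Finset.prod_range_succ']
    have h : ∀ j : ℕ, n + 1 + 1 + (j : ℤ) = n + 1 + ((j + 1 : ℕ) : ℤ) := fun j => by push_cast; ring
    simp only [h]
    rw [show n + 1 + (i : ℤ) = n + ((i + 1 : ℕ) : ℤ) by push_cast; ring]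
    simp
    ring

theorem summable_iterate_pderiv_of_neg (a : Laurent p) {n : ℤ} (hn : n < 0) :
    Summable fun i : ℕ => (pderiv^[i] a) n := by
  obtain ⟨m, rfl⟩ : ∃ m : ℕ, n = -(m + 1 : ℤ) := ⟨(-n - 1).toNat, by omega⟩
  refine summable_of_ne_finset_zero (s := Finset.range (m + 1)) fun i hi => ?_
  rw [Finset.mem_range, not_lt] at hi
  -- The factor n + 1 + m vanishes: derivatives never carry nonnegative powers of x to negative
  -- ones.
  rw [iterate_pderiv_apply, Finset.prod_eq_zero (i := m) (Finset.mem_range.2 (by omega)), zero_mul]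
  push_cast
  ring

theorem factorial_mul_iterate_pderiv (a : Laurent p) (n i : ℕ) :
    (n.factorial : ℚ_[p]) * (pderiv^[i] (divX a)) n =
      ((n + i + 1).factorial : ℚ_[p]) * a ((n + i + 1 : ℕ) : ℤ) / ((n + i + 1 : ℕ) : ℚ_[p]) := by
  have h : (n.factorial : ℚ_[p]) * ∏ j ∈ Finset.range i, (((n : ℤ) + 1 + j : ℤ) : ℚ_[p]) =
      ((n + i).factorial : ℚ_[p]) := by
    rw [← Nat.factorial_mul_ascFactorial, Nat.ascFactorial_eq_prod_range]
    push_cast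
    rfl
  rw [iterate_pderiv_apply, ← mul_assoc, h, Nat.factorial_succ, divX]
  have hne : ((n + i + 1 : ℕ) : ℚ_[p]) ≠ 0 := by exact_mod_cast Nat.succ_ne_zero (n + i)
  push_cast at hne ⊢
  field_simp

/-- The coefficients `n! a_n`, for `n ≥ 0`. -/
noncomputable def borel (a : Laurent p) (n : ℕ) : ℚ_[p] := (n.factorial : ℚ_[p]) * a (n : ℤ)

theorem Rapid.summable_iterate_pderiv {a : Laurent p} (ha : Rapid (borel a)) (n : ℤ) :
    Summable fun i : ℕ => (pderiv^[i] (divX a)) n := by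
  rcases lt_or_ge n 0 with hn | hn
  · exact summable_iterate_pderiv_of_neg _ hn
  · lift n to ℕ using hn
    have hf : (n.factorial : ℚ_[p]) ≠ 0 := by exact_mod_cast n.factorial_ne_zero
    rw [← summable_mul_left_iff hf]
    simp only [factorial_mul_iterate_pderiv]
    exact ha.summable_div n

theorem borel_Dx (a : Laurent p) : borel (Dx a) = tailSum (borel a) := by
  funext n
  rw [borel, Dx, derivSum, ← tsum_mul_left]
  simp only [factorial_mul_iterate_pderiv]
  rfl

theorem borel_iterate_Dx (a : Laurent p) (s : ℕ) : borel (Dx^[s] a) = tailSum^[s] (borel a) := by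
  induction s with
  | zero => rfl
  | succ s ih => rw [Function.iterate_succ_apply', Function.iterate_succ_apply', borel_Dx, ih]

theorem Rapid.iterate_tailSum {b : ℕ → ℚ_[p]} (hb : Rapid b) (s : ℕ) :
    Rapid (DworkGamma.tailSum^[s] b) := by
  induction s with
  | zero => exact hb
  | succ s ih => rw [Function.iterate_succ_apply']; exact ih.tailSum

/-! ### The Dwork exponential -/

open PowerSeries in
theorem derivative_dworkExp :
    derivative ℚ_[p] (dworkExp p) = (1 + X ^ (p - 1)) * dworkExp p := by
  have hp := (Fact.out : p.Prime)
  have hs : HasSubst (X + C ((p : ℚ_[p])⁻¹) * X ^ p : PowerSeries ℚ_[p]) :=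
    HasSubst.of_constantCoeff_zero' (by simp [hp.ne_zero])
  have hp0 : (p : ℚ_[p]) ≠ 0 := by exact_mod_cast hp.ne_zero
  have hC : C ((p : ℚ_[p])⁻¹) * (p : PowerSeries ℚ_[p]) = 1 := by
    rw [← map_natCast (C (R := ℚ_[p])), ← map_mul, inv_mul_cancel₀ hp0, map_one]
  rw [dworkExp, derivative_subst hs, derivative_exp, mul_comm]
  congr 1
  rw [map_add, derivative_X, Derivation.leibniz, derivative_C, derivative_pow, derivative_X]
  simp only [smul_eq_mul, mul_zero, add_zero, mul_one]
  rw [← mul_assoc, hC, one_mul]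

open PowerSeries in
theorem coeff_zero_dworkExp : coeff 0 (dworkExp p) = 1 := by
  have hp := (Fact.out : p.Prime)
  have hs : HasSubst (X + C ((p : ℚ_[p])⁻¹) * X ^ p : PowerSeries ℚ_[p]) :=
    HasSubst.of_constantCoeff_zero' (by simp [hp.ne_zero])
  rw [dworkExp, coeff_subst' hs, finsum_eq_single _ 0]
  · simp
  · intro n hn
    simp [hp.ne_zero, hn]

/-- `n!` times the `n`-th coefficient of the Dwork exponential. -/
noncomputable def dworkSeq (p : ℕ) [Fact p.Prime] (n : ℕ) : ℚ_[p] :=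
  (n.factorial : ℚ_[p]) * PowerSeries.coeff n (dworkExp p)

theorem dworkSeq_zero : dworkSeq p 0 = 1 := by
  simp [dworkSeq, coeff_zero_dworkExp, -PowerSeries.coeff_zero_eq_constantCoeff]

theorem borel_dworkExp : borel (ofPowerSeries (dworkExp p)) = dworkSeq p := by
  funext n
  simp [borel, ofPowerSeries, dworkSeq]

/-- Read off from f' = (1 + x^(p-1)) f; all estimates on the sequence come from this recursion. -/
theorem dworkSeq_succ (n : ℕ) : dworkSeq p (n + 1) =
    dworkSeq p n + (n.descFactorial (p - 1) : ℚ_[p]) * dworkSeq p (n - (p - 1)) := by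
  have h := congrArg (PowerSeries.coeff n) (derivative_dworkExp (p := p))
  rw [PowerSeries.coeff_derivative, add_mul, one_mul, map_add, PowerSeries.coeff_X_pow_mul'] at h
  have h1 : dworkSeq p (n + 1) = (n.factorial : ℚ_[p]) *
      (PowerSeries.coeff (n + 1) (dworkExp p) * ((n : ℚ_[p]) + 1)) := by
    rw [dworkSeq, Nat.factorial_succ]
    push_cast
    ring
  rw [h1, h, mul_add]
  congr 1
  split_ifs with hn
  · rw [dworkSeq, ← Nat.factorial_mul_descFactorial hn]
    push_cast
    ring
  · rw [Nat.descFactorial_eq_zero_iff_lt.2 (not_le.1 hn)]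
    simp

theorem norm_natCast_le_one (m : ℕ) : ‖(m : ℚ_[p])‖ ≤ 1 := by
  simpa using Padic.norm_int_le_one (p := p) (m : ℤ)

theorem norm_natCast_le_inv {m : ℕ} (h : p ∣ m) : ‖(m : ℚ_[p])‖ ≤ (p : ℝ)⁻¹ := by
  obtain ⟨k, rfl⟩ := h
  rw [Nat.cast_mul, norm_mul, Padic.norm_p]
  exact mul_le_of_le_one_right (by positivity) (norm_natCast_le_one k)

theorem norm_dworkSeq_le_one (n : ℕ) : ‖dworkSeq p n‖ ≤ 1 := by
  induction n using Nat.strong_induction_on with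
  | _ n ih =>
    cases n with
    | zero => simp [dworkSeq_zero]
    | succ n =>
      rw [dworkSeq_succ]
      refine (IsUltrametricDist.norm_add_le_max _ _).trans (max_le (ih n (by omega)) ?_)
      rw [norm_mul]
      exact mul_le_one₀ (norm_natCast_le_one _) (norm_nonneg _) (ih _ (by omega))

theorem dvd_descFactorial_of_not_dvd {n : ℕ} (h : ¬ p ∣ n + 1) :
    p ∣ n.descFactorial (p - 1) := by
  have hp := (Fact.out : p.Prime)
  have h1 : p ∣ (n + 1).descFactorial p :=
    (Nat.dvd_factorial hp.pos le_rfl).trans (Nat.factorial_dvd_descFactorial _ _)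
  obtain ⟨q, rfl⟩ : ∃ q, p = q + 1 := ⟨p - 1, by have := hp.pos; omega⟩
  rw [Nat.succ_descFactorial_succ] at h1
  exact (hp.dvd_mul.1 h1).resolve_left h

/-- Modulo p the product is (p-1)!, so this is Wilson's theorem. -/
theorem norm_descFactorial_add_one_le (j : ℕ) :
    ‖(((p * j + (p - 1)).descFactorial (p - 1) : ℕ) : ℚ_[p]) + 1‖ ≤ (p : ℝ)⁻¹ := by
  have hp := (Fact.out : p.Prime)
  have h : p ∣ (p * j + (p - 1)).descFactorial (p - 1) + 1 := by
    rw [← CharP.cast_eq_zero_iff (ZMod p) p, Nat.add_descFactorial_eq_ascFactorial,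
      Nat.ascFactorial_eq_prod_range]
    push_cast
    simp only [CharP.cast_eq_zero, zero_mul, zero_add]
    have hw := ZMod.wilsons_lemma p
    rw [← Nat.one_ascFactorial, Nat.ascFactorial_eq_prod_range] at hw
    push_cast at hw
    rw [hw]
    ring
  exact_mod_cast norm_natCast_le_inv h

/-- Within a block [pj, pj + p) the recursion adds only terms divisible by p, so the sequence is
constant up to ε/p. On entering the next block the coefficient is -1 mod p, so the two terms cancel
up to ε/p. One block is spent reaching back p - 1 indices and one on this cancellation, whence k +
2. -/
theorem norm_dworkSeq_le_of_forall_le {k : ℕ} {ε : ℝ} (h : ∀ n, p * k ≤ n → ‖dworkSeq p n‖ ≤ ε) :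
    ∀ n, p * (k + 2) ≤ n → ‖dworkSeq p n‖ ≤ (p : ℝ)⁻¹ * ε := by
  have hp := (Fact.out : p.Prime)
  have hp1 := hp.one_lt
  have hε : 0 ≤ ε := (norm_nonneg _).trans (h _ le_rfl)
  have step : ∀ n, p * (k + 1) ≤ n → ¬ p ∣ n + 1 →
      ‖dworkSeq p (n + 1) - dworkSeq p n‖ ≤ (p : ℝ)⁻¹ * ε := by
    intro n hn hd
    rw [dworkSeq_succ, add_sub_cancel_left, norm_mul]
    refine mul_le_mul (norm_natCast_le_inv (dvd_descFactorial_of_not_dvd hd)) (h _ ?_)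
      (norm_nonneg _) (by positivity)
    rw [mul_add] at hn
    omega
  have block : ∀ j, k + 1 ≤ j → ∀ i, i < p →
      ‖dworkSeq p (p * j + i) - dworkSeq p (p * j)‖ ≤ (p : ℝ)⁻¹ * ε := by
    intro j hj i hi
    induction i with
    | zero => simpa using by positivity
    | succ i ih =>
      have hd : ¬ p ∣ p * j + i + 1 := by
        rw [add_assoc, Nat.dvd_add_right (dvd_mul_right p j)]
        exact Nat.not_dvd_of_pos_of_lt (by omega) hi
      have h1 := step (p * j + i) ((Nat.mul_le_mul_left p hj).trans (by omega)) hd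
      rw [← add_assoc, ← sub_add_sub_cancel]
      exact (IsUltrametricDist.norm_add_le_max _ _).trans (max_le h1 (ih (by omega)))
  have jump : ∀ j, k + 1 ≤ j → ‖dworkSeq p (p * (j + 1))‖ ≤ (p : ℝ)⁻¹ * ε := by
    intro j hj
    have e1 : p * (j + 1) = p * j + (p - 1) + 1 := by rw [mul_add]; omega
    rw [e1, dworkSeq_succ, Nat.add_sub_cancel]
    have e2 : dworkSeq p (p * j + (p - 1)) +
        (((p * j + (p - 1)).descFactorial (p - 1) : ℕ) : ℚ_[p]) * dworkSeq p (p * j) =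
        (dworkSeq p (p * j + (p - 1)) - dworkSeq p (p * j)) +
        ((((p * j + (p - 1)).descFactorial (p - 1) : ℕ) : ℚ_[p]) + 1) * dworkSeq p (p * j) := by
      ring
    rw [e2]
    refine (IsUltrametricDist.norm_add_le_max _ _).trans
      (max_le (block j hj (p - 1) (by omega)) ?_)
    rw [norm_mul]
    exact mul_le_mul (norm_descFactorial_add_one_le j)
      (h _ (Nat.mul_le_mul_left p (by omega))) (norm_nonneg _) (by positivity)
  intro n hn
  have hdiv : k + 2 ≤ n / p := (Nat.le_div_iff_mul_le hp.pos).2 (by rwa [mul_comm])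
  obtain ⟨j, hj⟩ : ∃ j, n / p = j + 1 := ⟨n / p - 1, by omega⟩
  have hn' : n = p * (j + 1) + n % p := by rw [← hj]; exact (Nat.div_add_mod n p).symm
  rw [hn', ← sub_add_cancel (dworkSeq p (p * (j + 1) + n % p)) (dworkSeq p (p * (j + 1)))]
  exact (IsUltrametricDist.norm_add_le_max _ _).trans
    (max_le (block (j + 1) (by omega) _ (Nat.mod_lt n hp.pos)) (jump j (by omega)))

theorem norm_dworkSeq_le_pow (e : ℕ) : ∀ n, p * (2 * e) ≤ n → ‖dworkSeq p n‖ ≤ (p : ℝ)⁻¹ ^ e := by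
  induction e with
  | zero => intro n _; simpa using norm_dworkSeq_le_one n
  | succ e ih =>
    intro n hn
    rw [pow_succ']
    exact norm_dworkSeq_le_of_forall_le ih n (by rwa [mul_add] at hn)

theorem rapid_dworkSeq : Rapid (dworkSeq p) := by
  have hp := (Fact.out : p.Prime)
  intro k
  have hlt : |(p : ℝ)⁻¹| < 1 := by
    rw [abs_of_nonneg (by positivity)]
    exact inv_lt_one_of_one_lt₀ (by exact_mod_cast hp.one_lt)
  have hlim := ((tendsto_pow_const_mul_const_pow_of_abs_lt_one k hlt).comp
    (tendsto_add_atTop_nat 1)).bddAbove_range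
  obtain ⟨C, hC⟩ := hlim
  -- With e = ⌊n/(2p)⌋, the bounds n ≤ 2p(e+1) and |b(n)| ≤ p^(-e) give (2p)^k and the extra factor
  -- p.
  refine ⟨(2 * p : ℝ) ^ k * (p * C), fun n => ?_⟩
  have hp0 : (0 : ℝ) < p := by exact_mod_cast hp.pos
  set e := n / (2 * p) with he
  have hpos : 0 < 2 * p := by have := hp.pos; omega
  have h1 : ‖dworkSeq p n‖ ≤ (p : ℝ)⁻¹ ^ e := by
    refine norm_dworkSeq_le_pow e n ?_
    calc p * (2 * e) = 2 * p * (n / (2 * p)) := by rw [he]; ring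
      _ ≤ n := Nat.mul_div_le n (2 * p)
  have h2 : (n : ℝ) ≤ 2 * p * (e + 1 : ℕ) := by
    exact_mod_cast (Nat.lt_mul_div_succ n hpos).le
  have h3 : ((e + 1 : ℕ) : ℝ) ^ k * (p : ℝ)⁻¹ ^ (e + 1) ≤ C := hC ⟨e, rfl⟩
  calc (n : ℝ) ^ k * ‖dworkSeq p n‖ ≤ (2 * p * (e + 1 : ℕ) : ℝ) ^ k * (p : ℝ)⁻¹ ^ e := by gcongr
    _ = (2 * p : ℝ) ^ k * (p * (((e + 1 : ℕ) : ℝ) ^ k * (p : ℝ)⁻¹ ^ (e + 1))) := by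
        rw [mul_pow, pow_succ (p : ℝ)⁻¹ e]
        field_simp
    _ ≤ _ := by gcongr

/-! ### Values of the alternating sums of the Dwork sequence -/

open PowerSeries in
theorem derivative_rescale {K : Type*} [CommRing K] (a : K) (f : PowerSeries K) :
    derivative K (rescale a f) = C a * rescale a (derivative K f) := by
  ext n
  simp only [coeff_derivative, coeff_rescale, coeff_C_mul]
  ring

/-- The series `exp(x) f(-x)`, for `f` the Dwork exponential. -/
noncomputable def dworkTwist (p : ℕ) [Fact p.Prime] : PowerSeries ℚ_[p] :=
  PowerSeries.exp ℚ_[p] * PowerSeries.rescale (-1) (dworkExp p)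

open PowerSeries in
-- Oddness of p makes (-x)^(p-1) = x^(p-1); the e^x factor then cancels the linear part of the
-- exponent, leaving exp(-x^p/p).
theorem derivative_dworkTwist (hp2 : p ≠ 2) :
    derivative ℚ_[p] (dworkTwist p) = -(X ^ (p - 1) * dworkTwist p) := by
  have hev : Even (p - 1) := (Fact.out : p.Prime).even_sub_one hp2
  rw [dworkTwist, Derivation.leibniz, derivative_exp, derivative_rescale, derivative_dworkExp,
    map_mul, map_add, map_one, map_pow, rescale_X, map_neg, map_one, mul_pow, hev.neg_one_pow]
  simp only [smul_eq_mul]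
  ring

theorem altSum_dworkSeq (N : ℕ) :
    altSum N (dworkSeq p) = (N.factorial : ℚ_[p]) * PowerSeries.coeff N (dworkTwist p) := by
  rw [dworkTwist, mul_comm (PowerSeries.exp _), PowerSeries.coeff_mul,
    Finset.Nat.sum_antidiagonal_eq_sum_range_succ_mk, altSum, Finset.mul_sum]
  refine Finset.sum_congr rfl fun n hn => ?_
  have hn' : n ≤ N := Nat.lt_succ_iff.1 (Finset.mem_range.1 hn)
  rw [PowerSeries.coeff_rescale, PowerSeries.coeff_exp, dworkSeq,
    ← Nat.choose_mul_factorial_mul_factorial hn']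
  have : ((N - n).factorial : ℚ_[p]) ≠ 0 := by exact_mod_cast Nat.factorial_ne_zero _
  push_cast
  field_simp

/-- The positive integers below `N` that are prime to `p`. -/
def unitsBelow (p N : ℕ) : Finset ℕ := (Finset.range N).filter fun j => ¬ p ∣ j

theorem prod_unitsBelow_mul_succ (k : ℕ) :
    ∏ j ∈ unitsBelow p (p * (k + 1)), (j : ℚ_[p]) =
      (∏ j ∈ unitsBelow p (p * k), (j : ℚ_[p])) * ((p * k + 1).ascFactorial (p - 1) : ℕ) := by
  have hp := (Fact.out : p.Prime)
  rw [unitsBelow, Finset.prod_filter, mul_add, mul_one, Finset.prod_range_add, unitsBelow,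
    Finset.prod_filter]
  congr 1
  have hpos := hp.pos
  have hs : Finset.range p = Finset.range (p - 1 + 1) := by congr 1; omega
  rw [hs, Finset.prod_range_succ', Nat.ascFactorial_eq_prod_range]
  simp only [add_zero, dvd_mul_right, not_true_eq_false, if_false, mul_one]
  push_cast
  refine Finset.prod_congr rfl fun i hi => ?_
  have hi' := Finset.mem_range.1 hi
  have hd : ¬ p ∣ p * k + (i + 1) := by
    rw [Nat.dvd_add_right (dvd_mul_right p k)]
    exact Nat.not_dvd_of_pos_of_lt (by omega) (by omega)
  rw [if_pos hd]
  ring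

theorem altSum_dworkSeq_mul (hp2 : p ≠ 2) (k : ℕ) :
    altSum (p * k) (dworkSeq p) = (-1) ^ k * ∏ j ∈ unitsBelow p (p * k), (j : ℚ_[p]) := by
  have hp := (Fact.out : p.Prime)
  induction k with
  | zero => simp [altSum, unitsBelow, dworkSeq_zero]
  | succ k ih =>
    rw [prod_unitsBelow_mul_succ, pow_succ]
    have e1 : p * (k + 1) = p * k + (p - 1) + 1 := by have := hp.pos; rw [mul_add]; omega
    have h := congrArg (PowerSeries.coeff (p * k + (p - 1))) (derivative_dworkTwist hp2)
    rw [PowerSeries.coeff_derivative, map_neg, PowerSeries.coeff_X_pow_mul] at h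
    have hfac : (((p * k + (p - 1)).factorial : ℕ) : ℚ_[p]) =
        ((p * k).factorial : ℚ_[p]) * ((p * k + 1).ascFactorial (p - 1) : ℕ) := by
      rw [← Nat.factorial_mul_ascFactorial]
      push_cast
      rfl
    rw [altSum_dworkSeq, e1, Nat.factorial_succ, Nat.cast_mul, hfac]
    rw [altSum_dworkSeq] at ih
    push_cast at h ⊢
    linear_combination ((p * k).factorial : ℚ_[p]) * ((p * k + 1).ascFactorial (p - 1) : ℕ) * h -
      ((p * k + 1).ascFactorial (p - 1) : ℕ) * ih

/-! ### Sums and products over integers prime to `p` -/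

theorem norm_natCast_eq_one {j : ℕ} (h : ¬ p ∣ j) : ‖(j : ℚ_[p])‖ = 1 := by
  rw [Padic.norm_natCast_eq_one_iff]
  exact ((Fact.out : p.Prime).coprime_iff_not_dvd).2 h

theorem natCast_ne_zero_of_not_dvd {j : ℕ} (h : ¬ p ∣ j) : (j : ℚ_[p]) ≠ 0 :=
  norm_ne_zero_iff.1 (by rw [norm_natCast_eq_one h]; exact one_ne_zero)

theorem not_dvd_of_mem_unitsBelow {p N j : ℕ} (h : j ∈ unitsBelow p N) : ¬ p ∣ j :=
  (Finset.mem_filter.1 h).2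

theorem lt_of_mem_unitsBelow {p N j : ℕ} (h : j ∈ unitsBelow p N) : j < N :=
  Finset.mem_range.1 (Finset.mem_filter.1 h).1

theorem sub_mem_unitsBelow {p N j : ℕ} (hN : p ∣ N) (h : j ∈ unitsBelow p N) :
    N - j ∈ unitsBelow p N := by
  have h1 := lt_of_mem_unitsBelow h
  have h2 := not_dvd_of_mem_unitsBelow h
  have h3 : j ≠ 0 := by rintro rfl; exact h2 (dvd_zero p)
  refine Finset.mem_filter.2 ⟨Finset.mem_range.2 (by omega), fun hd => h2 ?_⟩
  exact (Nat.dvd_sub_iff_right h1.le hN).1 hd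

theorem prod_unitsBelow_reflect {M : Type*} [CommMonoid M] {p N : ℕ} (hN : p ∣ N) (f : ℕ → M) :
    ∏ j ∈ unitsBelow p N, f (N - j) = ∏ j ∈ unitsBelow p N, f j := by
  refine Finset.prod_nbij' (fun j => N - j) (fun j => N - j)
    (fun j hj => sub_mem_unitsBelow hN hj) (fun j hj => sub_mem_unitsBelow hN hj) ?_ ?_
    (fun j _ => rfl)
  all_goals
    intro j hj
    have := lt_of_mem_unitsBelow hj
    omega

theorem sum_unitsBelow_reflect {M : Type*} [AddCommMonoid M] {p N : ℕ} (hN : p ∣ N) (f : ℕ → M) :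
    ∑ j ∈ unitsBelow p N, f (N - j) = ∑ j ∈ unitsBelow p N, f j :=
  prod_unitsBelow_reflect (M := Multiplicative M) hN f

theorem prod_unitsBelow_two_mul {M : Type*} [CommMonoid M] {p N : ℕ} (hN : p ∣ N) (f : ℕ → M) :
    ∏ j ∈ unitsBelow p (2 * N), f j =
      (∏ j ∈ unitsBelow p N, f j) * ∏ j ∈ unitsBelow p N, f (N + j) := by
  simp only [unitsBelow, Finset.prod_filter]
  rw [two_mul, Finset.prod_range_add]
  simp only [Nat.dvd_add_right hN]

theorem sum_unitsBelow_two_mul {M : Type*} [AddCommMonoid M] {p N : ℕ} (hN : p ∣ N) (f : ℕ → M) :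
    ∑ j ∈ unitsBelow p (2 * N), f j =
      (∑ j ∈ unitsBelow p N, f j) + ∑ j ∈ unitsBelow p N, f (N + j) :=
  prod_unitsBelow_two_mul (M := Multiplicative M) hN f

/-- By the ultrametric inequality the terms of degree at least 2 are bounded by ε² whatever the
number of factors. -/
theorem norm_prod_one_add_sub_le {ι : Type*} (s : Finset ι) (y : ι → ℚ_[p]) {ε : ℝ}
    (h0 : 0 ≤ ε) (h1 : ε ≤ 1) (hy : ∀ i ∈ s, ‖y i‖ ≤ ε) :
    ‖∏ i ∈ s, (1 + y i) - 1 - ∑ i ∈ s, y i‖ ≤ ε ^ 2 := by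
  classical
  induction s using Finset.induction_on with
  | empty => simpa using by positivity
  | insert a s ha ih =>
    have ih' := ih fun i hi => hy i (Finset.mem_insert_of_mem hi)
    have hya := hy a (Finset.mem_insert_self a s)
    have hs : ‖∑ i ∈ s, y i‖ ≤ ε :=
      IsUltrametricDist.norm_sum_le_of_forall_le_of_nonneg h0
        fun i hi => hy i (Finset.mem_insert_of_mem hi)
    rw [Finset.prod_insert ha, Finset.sum_insert ha]
    have e : (1 + y a) * ∏ i ∈ s, (1 + y i) - 1 - (y a + ∑ i ∈ s, y i) =
        (1 + y a) * (∏ i ∈ s, (1 + y i) - 1 - ∑ i ∈ s, y i) + y a * ∑ i ∈ s, y i := by ring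
    rw [e]
    refine (IsUltrametricDist.norm_add_le_max _ _).trans (max_le ?_ ?_)
    · rw [norm_mul]
      refine (mul_le_of_le_one_left (norm_nonneg _) ?_).trans ih'
      exact (IsUltrametricDist.norm_add_le_max _ _).trans (max_le (by simp) (hya.trans h1))
    · rw [norm_mul, sq]
      exact mul_le_mul hya hs (norm_nonneg _) h0

/-- The sum `∑ j⁻²` over `0 < j < N` prime to `p`. -/
noncomputable def sumInvSq (p : ℕ) [Fact p.Prime] (N : ℕ) : ℚ_[p] :=
  ∑ j ∈ unitsBelow p N, ((j : ℚ_[p]) ^ 2)⁻¹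

theorem norm_two_eq_one (hp2 : p ≠ 2) : ‖(2 : ℚ_[p])‖ = 1 := by
  have h : ¬ p ∣ 2 := fun h => hp2 ((Nat.prime_dvd_prime_iff_eq Fact.out Nat.prime_two).1 h)
  exact_mod_cast norm_natCast_eq_one h

theorem norm_sum_inv_mul_add_sumInvSq_le (hp2 : p ≠ 2) {N : ℕ} (hN : p ∣ N) :
    ‖∑ j ∈ unitsBelow p N, ((j : ℚ_[p]) * ((N - j : ℕ) : ℚ_[p]))⁻¹ + sumInvSq p N‖ ≤
      ‖(N : ℚ_[p])‖ ^ 2 := by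
  set f : ℕ → ℚ_[p] := fun j => ((j : ℚ_[p]) ^ 2 * ((N - j : ℕ) : ℚ_[p]))⁻¹ with hf
  have h1 : ∑ j ∈ unitsBelow p N, ((j : ℚ_[p]) * ((N - j : ℕ) : ℚ_[p]))⁻¹ + sumInvSq p N =
      N * ∑ j ∈ unitsBelow p N, f j := by
    rw [sumInvSq, ← Finset.sum_add_distrib, Finset.mul_sum]
    refine Finset.sum_congr rfl fun j hj => ?_
    have hj0 := natCast_ne_zero_of_not_dvd (not_dvd_of_mem_unitsBelow hj)
    have hj1 := natCast_ne_zero_of_not_dvd (not_dvd_of_mem_unitsBelow (sub_mem_unitsBelow hN hj))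
    have hc : ((N - j : ℕ) : ℚ_[p]) = N - j := Nat.cast_sub (lt_of_mem_unitsBelow hj).le
    rw [hc] at hj1
    simp only [hf, hc]
    field_simp
    ring
  -- Symmetrising under j ↔ N - j extracts a second factor N; p odd makes the 2 harmless.
  have h2 : 2 * ∑ j ∈ unitsBelow p N, f j =
      N * ∑ j ∈ unitsBelow p N, (((j : ℚ_[p]) * ((N - j : ℕ) : ℚ_[p])) ^ 2)⁻¹ := by
    rw [two_mul]
    nth_rewrite 2 [← sum_unitsBelow_reflect hN f]
    rw [← Finset.sum_add_distrib, Finset.mul_sum]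
    refine Finset.sum_congr rfl fun j hj => ?_
    have hj0 := natCast_ne_zero_of_not_dvd (not_dvd_of_mem_unitsBelow hj)
    have hj1 := natCast_ne_zero_of_not_dvd (not_dvd_of_mem_unitsBelow (sub_mem_unitsBelow hN hj))
    have hlt := lt_of_mem_unitsBelow hj
    have hc : ((N - j : ℕ) : ℚ_[p]) = N - j := Nat.cast_sub hlt.le
    have hc2 : N - (N - j) = j := by omega
    rw [hc] at hj1
    simp only [hf, hc2, hc]
    field_simp
    ring
  have h3 : ‖∑ j ∈ unitsBelow p N, f j‖ ≤ ‖(N : ℚ_[p])‖ := by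
    have h4 := congrArg norm h2
    rw [norm_mul, norm_mul, norm_two_eq_one hp2, one_mul] at h4
    rw [h4]
    refine mul_le_of_le_one_right (norm_nonneg _)
      (IsUltrametricDist.norm_sum_le_of_forall_le_of_nonneg zero_le_one fun j hj => ?_)
    rw [norm_inv, norm_pow, norm_mul, norm_natCast_eq_one (not_dvd_of_mem_unitsBelow hj),
      norm_natCast_eq_one (not_dvd_of_mem_unitsBelow (sub_mem_unitsBelow hN hj))]
    simp
  rw [h1, norm_mul, sq]
  exact mul_le_mul_of_nonneg_left h3 (norm_nonneg _)

/-- Squaring allows pairing j with N - j: (1 + N/j)(1 + N/(N-j)) = 1 + 2N²/(j(N-j)). The terms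
linear in N disappear, so the error is of order N⁴. -/
theorem norm_sq_prod_sub_le (hp2 : p ≠ 2) {N : ℕ} (hN : p ∣ N) :
    ‖(∏ j ∈ unitsBelow p N, (1 + (N : ℚ_[p]) / j)) ^ 2 - 1 + 2 * (N : ℚ_[p]) ^ 2 * sumInvSq p N‖ ≤
      ‖(N : ℚ_[p])‖ ^ 4 := by
  set y : ℕ → ℚ_[p] := fun j => 2 * (N : ℚ_[p]) ^ 2 * ((j : ℚ_[p]) * ((N - j : ℕ) : ℚ_[p]))⁻¹
    with hy
  have hQ : (∏ j ∈ unitsBelow p N, (1 + (N : ℚ_[p]) / j)) ^ 2 =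
      ∏ j ∈ unitsBelow p N, (1 + y j) := by
    rw [sq]
    nth_rewrite 2 [← prod_unitsBelow_reflect hN fun j => 1 + (N : ℚ_[p]) / j]
    rw [← Finset.prod_mul_distrib]
    refine Finset.prod_congr rfl fun j hj => ?_
    have hj0 := natCast_ne_zero_of_not_dvd (not_dvd_of_mem_unitsBelow hj)
    have hj1 := natCast_ne_zero_of_not_dvd (not_dvd_of_mem_unitsBelow (sub_mem_unitsBelow hN hj))
    have hc : ((N - j : ℕ) : ℚ_[p]) = N - j := Nat.cast_sub (lt_of_mem_unitsBelow hj).le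
    rw [hc] at hj1
    simp only [hy, hc]
    field_simp
    ring
  have hle := norm_prod_one_add_sub_le (unitsBelow p N) y (ε := ‖(N : ℚ_[p])‖ ^ 2) (by positivity)
    (pow_le_one₀ (norm_nonneg _) (norm_natCast_le_one N)) (fun j hj => by
      rw [hy]
      simp only
      rw [norm_mul, norm_inv, norm_mul, norm_mul, norm_two_eq_one hp2, norm_pow,
        norm_natCast_eq_one (not_dvd_of_mem_unitsBelow hj),
        norm_natCast_eq_one (not_dvd_of_mem_unitsBelow (sub_mem_unitsBelow hN hj))]
      simp)
  have hsum : ∑ j ∈ unitsBelow p N, y j = 2 * (N : ℚ_[p]) ^ 2 *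
      ∑ j ∈ unitsBelow p N, ((j : ℚ_[p]) * ((N - j : ℕ) : ℚ_[p]))⁻¹ := by
    rw [Finset.mul_sum]
  rw [hsum] at hle
  rw [hQ]
  have e : ∏ j ∈ unitsBelow p N, (1 + y j) - 1 + 2 * (N : ℚ_[p]) ^ 2 * sumInvSq p N =
      (∏ j ∈ unitsBelow p N, (1 + y j) - 1 - 2 * (N : ℚ_[p]) ^ 2 *
        ∑ j ∈ unitsBelow p N, ((j : ℚ_[p]) * ((N - j : ℕ) : ℚ_[p]))⁻¹) +
      2 * (N : ℚ_[p]) ^ 2 *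
        (∑ j ∈ unitsBelow p N, ((j : ℚ_[p]) * ((N - j : ℕ) : ℚ_[p]))⁻¹ + sumInvSq p N) := by
    ring
  rw [e]
  refine (IsUltrametricDist.norm_add_le_max _ _).trans (max_le (hle.trans (by rw [← pow_mul])) ?_)
  rw [norm_mul, norm_mul, norm_two_eq_one hp2, norm_pow, one_mul,
    show ‖(N : ℚ_[p])‖ ^ 4 = ‖(N : ℚ_[p])‖ ^ 2 * ‖(N : ℚ_[p])‖ ^ 2 by ring]
  exact mul_le_mul_of_nonneg_left (norm_sum_inv_mul_add_sumInvSq_le hp2 hN) (by positivity)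

/-- The even powers remove the signs, and the product up to 2N is P² ∏(1 + N/j), with P the product
up to N, a p-adic unit. -/
theorem norm_altSum_two_mul_sub_le (hp2 : p ≠ 2) {N : ℕ} (hN : p ∣ N) :
    ‖altSum (2 * N) (dworkSeq p) ^ 2 - altSum N (dworkSeq p) ^ 4 +
      2 * (N : ℚ_[p]) ^ 2 * sumInvSq p N * altSum N (dworkSeq p) ^ 4‖ ≤ ‖(N : ℚ_[p])‖ ^ 4 := by
  set P := ∏ j ∈ unitsBelow p N, (j : ℚ_[p]) with hP
  have hA : altSum N (dworkSeq p) ^ 4 = P ^ 4 := by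
    obtain ⟨m, rfl⟩ := hN
    rw [altSum_dworkSeq_mul hp2, mul_pow, ← pow_mul, mul_comm m, pow_mul]
    norm_num [hP]
  have hB : altSum (2 * N) (dworkSeq p) =
      P ^ 2 * ∏ j ∈ unitsBelow p N, (1 + (N : ℚ_[p]) / j) := by
    have h1 : altSum (2 * N) (dworkSeq p) = ∏ j ∈ unitsBelow p (2 * N), (j : ℚ_[p]) := by
      obtain ⟨m, rfl⟩ := hN
      rw [show 2 * (p * m) = p * (2 * m) by ring, altSum_dworkSeq_mul hp2, pow_mul]
      norm_num
    rw [h1, prod_unitsBelow_two_mul hN, sq, mul_assoc, ← hP]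
    congr 1
    rw [hP, ← Finset.prod_mul_distrib]
    refine Finset.prod_congr rfl fun j hj => ?_
    have hj0 := natCast_ne_zero_of_not_dvd (not_dvd_of_mem_unitsBelow hj)
    push_cast
    field_simp
    ring
  have hPn : ‖P‖ = 1 := by
    rw [hP, norm_prod]
    exact Finset.prod_eq_one fun j hj => norm_natCast_eq_one (not_dvd_of_mem_unitsBelow hj)
  have e : (P ^ 2 * ∏ j ∈ unitsBelow p N, (1 + (N : ℚ_[p]) / j)) ^ 2 - P ^ 4 +
      2 * (N : ℚ_[p]) ^ 2 * sumInvSq p N * P ^ 4 =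
      P ^ 4 * ((∏ j ∈ unitsBelow p N, (1 + (N : ℚ_[p]) / j)) ^ 2 - 1 +
        2 * (N : ℚ_[p]) ^ 2 * sumInvSq p N) := by ring
  rw [hA, hB, e, norm_mul, norm_pow, hPn, one_pow, one_mul]
  exact norm_sq_prod_sub_le hp2 hN

theorem norm_sumInvSq_two_mul_sub_le {N : ℕ} (hN : p ∣ N) :
    ‖sumInvSq p (2 * N) - 2 * sumInvSq p N‖ ≤ ‖(N : ℚ_[p])‖ := by
  rw [sumInvSq, sum_unitsBelow_two_mul hN, sumInvSq, two_mul, add_sub_add_left_eq_sub,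
    ← Finset.sum_sub_distrib]
  refine IsUltrametricDist.norm_sum_le_of_forall_le_of_nonneg (norm_nonneg _) fun j hj => ?_
  have hj := not_dvd_of_mem_unitsBelow hj
  have hNj : ¬ p ∣ N + j := by rwa [Nat.dvd_add_right hN]
  have hj0 := natCast_ne_zero_of_not_dvd hj
  have hNj0 := natCast_ne_zero_of_not_dvd hNj
  have e : (((N + j : ℕ) : ℚ_[p]) ^ 2)⁻¹ - ((j : ℚ_[p]) ^ 2)⁻¹ =
      (N : ℚ_[p]) * (-((N + 2 * j : ℕ) : ℚ_[p]) * ((((N + j : ℕ) : ℚ_[p]) ^ 2)⁻¹ *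
        ((j : ℚ_[p]) ^ 2)⁻¹)) := by
    push_cast at hNj0 ⊢
    field_simp
    ring
  rw [e, norm_mul]
  refine mul_le_of_le_one_right (norm_nonneg _) ?_
  rw [norm_mul, norm_mul, norm_inv, norm_inv, norm_pow, norm_pow, norm_natCast_eq_one hj,
    norm_natCast_eq_one hNj, norm_neg]
  simpa using norm_natCast_le_one (p := p) (N + 2 * j)

/-! ### Limits -/

/-- The coefficient `[D_x^s f]_0` of the Dwork exponential. -/
noncomputable def dworkCoeff (p : ℕ) [Fact p.Prime] (s : ℕ) : ℚ_[p] :=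
  (tailSum^[s] (dworkSeq p)) 0

theorem altSum_dworkSeq_expansion (N : ℕ) :
    altSum N (dworkSeq p) = 1 - N * (dworkCoeff p 1 - N * (dworkCoeff p 2 -
      N * altSum N (tailSum^[3] (dworkSeq p)))) := by
  have h0 := (rapid_dworkSeq (p := p)).altSum_eq N
  have h1 := ((rapid_dworkSeq (p := p)).iterate_tailSum 1).altSum_eq N
  have h2 := ((rapid_dworkSeq (p := p)).iterate_tailSum 2).altSum_eq N
  rw [h0, dworkSeq_zero]
  change 1 - N * altSum N (tailSum^[1] (dworkSeq p)) = _
  rw [h1]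
  change 1 - N * (dworkCoeff p 1 - N * altSum N (tailSum^[2] (dworkSeq p))) = _
  rw [h2]
  rfl

variable {N : ℕ → ℕ}

theorem tendsto_two_mul (hN : Tendsto (fun k => (N k : ℚ_[p])) atTop (𝓝 0)) :
    Tendsto (fun k => ((2 * N k : ℕ) : ℚ_[p])) atTop (𝓝 0) := by
  simpa using hN.const_mul 2

theorem tendsto_altSum_dworkSeq (hN : Tendsto (fun k => (N k : ℚ_[p])) atTop (𝓝 0)) :
    Tendsto (fun k => altSum (N k) (dworkSeq p)) atTop (𝓝 1) := by
  simpa [dworkSeq_zero] using (rapid_dworkSeq (p := p)).tendsto_altSum hN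

theorem tendsto_natCast_pow_succ :
    Tendsto (fun k : ℕ => ((p ^ (k + 1) : ℕ) : ℚ_[p])) atTop (𝓝 0) := by
  have h : ‖(p : ℚ_[p])‖ < 1 := Padic.norm_p_lt_one
  simpa [Function.comp_def] using
    (tendsto_pow_atTop_nhds_zero_of_norm_lt_one h).comp (tendsto_add_atTop_nat 1)

/-- The expansions of A_N and A_{2N} are substituted into the preceding congruence and divided by
N²: the terms of order 0 and 1 in N cancel in A_{2N}² - A_N⁴, and the error O(N⁴) becomes O(N²). -/
theorem exists_two_mul_sumInvSq_eq (hp2 : p ≠ 2) {N : ℕ} (hd : p ∣ N) (h0 : N ≠ 0)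
    (g1 g2 r r' : ℚ_[p])
    (hg1 : g1 = dworkCoeff p 1) (hg2 : g2 = dworkCoeff p 2)
    (hr : r = altSum N (tailSum^[3] (dworkSeq p)))
    (hr' : r' = altSum (2 * N) (tailSum^[3] (dworkSeq p))) :
    ∃ e : ℚ_[p], ‖e‖ ≤ ‖(N : ℚ_[p])‖ ^ 2 ∧
      sumInvSq p N * (2 * altSum N (dworkSeq p) ^ 4) = e - (4 * g2 + 4 * N * (r - 4 * r') +
      4 * (g1 - 2 * N * (g2 - 2 * N * r')) ^ 2 - 6 * (g1 - N * (g2 - N * r)) ^ 2 +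
      4 * N * (g1 - N * (g2 - N * r)) ^ 3 - (N : ℚ_[p]) ^ 2 * (g1 - N * (g2 - N * r)) ^ 4) := by
  have hN0 : (N : ℚ_[p]) ≠ 0 := by exact_mod_cast h0
  refine ⟨(altSum (2 * N) (dworkSeq p) ^ 2 - altSum N (dworkSeq p) ^ 4 +
    2 * (N : ℚ_[p]) ^ 2 * sumInvSq p N * altSum N (dworkSeq p) ^ 4) / (N : ℚ_[p]) ^ 2, ?_, ?_⟩
  · rw [norm_div, norm_pow, div_le_iff₀ (by have := norm_pos_iff.2 hN0; positivity), ← pow_add]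
    exact norm_altSum_two_mul_sub_le hp2 hd
  · have eA := altSum_dworkSeq_expansion (p := p) N
    have eB := altSum_dworkSeq_expansion (p := p) (2 * N)
    rw [← hg1, ← hg2, ← hr] at eA
    rw [← hg1, ← hg2, ← hr'] at eB
    push_cast at eB
    rw [eq_sub_iff_add_eq, eq_div_iff (pow_ne_zero 2 hN0), eB, eA]
    ring

theorem tendsto_sumInvSq (hp2 : p ≠ 2) (hd : ∀ k, p ∣ N k) (h0 : ∀ k, N k ≠ 0)
    (hN : Tendsto (fun k => (N k : ℚ_[p])) atTop (𝓝 0)) :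
    Tendsto (fun k => sumInvSq p (N k)) atTop (𝓝 (dworkCoeff p 1 ^ 2 - 2 * dworkCoeff p 2)) := by
  have hr := (rapid_dworkSeq (p := p).iterate_tailSum 3).tendsto_altSum hN
  have hr' := (rapid_dworkSeq (p := p).iterate_tailSum 3).tendsto_altSum (tendsto_two_mul hN)
  have hA := tendsto_altSum_dworkSeq hN
  choose e he heq using fun k =>
    exists_two_mul_sumInvSq_eq hp2 (hd k) (h0 k) _ _ _ _ rfl rfl rfl rfl
  have he0 : Tendsto e atTop (𝓝 0) := squeeze_zero_norm he (by simpa using hN.norm.pow 2)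
  set g1 := dworkCoeff p 1
  set g2 := dworkCoeff p 2
  have ha := tendsto_const_nhds (x := g1).sub (hN.mul (tendsto_const_nhds (x := g2).sub (hN.mul hr)))
  have hb := tendsto_const_nhds (x := g1).sub
    ((hN.const_mul 2).mul (tendsto_const_nhds (x := g2).sub ((hN.const_mul 2).mul hr')))
  have hX := he0.sub (((((tendsto_const_nhds (x := 4 * g2).add
    ((hN.const_mul 4).mul (hr.sub (hr'.const_mul 4)))).add
    ((hb.pow 2).const_mul 4)).sub ((ha.pow 2).const_mul 6)).add
    ((hN.const_mul 4).mul (ha.pow 3))).sub ((hN.pow 2).mul (ha.pow 4)))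
  have hlim := hX.div ((hA.pow 4).const_mul 2) (by norm_num)
  refine Tendsto.congr' ?_ (hlim.trans_eq (by congr 1; ring))
  filter_upwards [hA.eventually_ne one_ne_zero] with k hk
  rw [Pi.div_apply, div_eq_iff (by simpa using hk), heq k]

/-- The common limit L of S(N) and S(2N) satisfies L = 2L, hence is 0. -/
theorem dworkCoeff_two (hp2 : p ≠ 2) : dworkCoeff p 2 = dworkCoeff p 1 ^ 2 / 2 := by
  have hp := (Fact.out : p.Prime)
  have hd : ∀ k : ℕ, p ∣ p ^ (k + 1) := fun k => dvd_pow_self p k.succ_ne_zero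
  have h0 : ∀ k : ℕ, p ^ (k + 1) ≠ 0 := fun k => pow_ne_zero _ hp.ne_zero
  have hN := tendsto_natCast_pow_succ (p := p)
  have h1 := tendsto_sumInvSq hp2 hd h0 hN
  have h2 := tendsto_sumInvSq hp2 (fun k => (hd k).mul_left 2)
    (fun k => mul_ne_zero two_ne_zero (h0 k)) (tendsto_two_mul hN)
  have h3 : Tendsto (fun k : ℕ => sumInvSq p (2 * p ^ (k + 1)) - 2 * sumInvSq p (p ^ (k + 1)))
      atTop (𝓝 0) :=
    squeeze_zero_norm (fun k => norm_sumInvSq_two_mul_sub_le (hd k)) (by simpa using hN.norm)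
  have h4 := tendsto_nhds_unique h3 (h2.sub (h1.const_mul 2))
  linear_combination -h4 / 2

theorem tendsto_sumInvSq_div (hp2 : p ≠ 2) (hd : ∀ k, p ∣ N k) (h0 : ∀ k, N k ≠ 0)
    (hN : Tendsto (fun k => (N k : ℚ_[p])) atTop (𝓝 0)) :
    Tendsto (fun k => sumInvSq p (N k) / (N k : ℚ_[p])) atTop
      (𝓝 (6 * (dworkCoeff p 3 - dworkCoeff p 1 ^ 3 / 6))) := by
  have hr := (rapid_dworkSeq (p := p).iterate_tailSum 3).tendsto_altSum hN
  have hr' := (rapid_dworkSeq (p := p).iterate_tailSum 3).tendsto_altSum (tendsto_two_mul hN)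
  have hA := tendsto_altSum_dworkSeq hN
  have hN0 : ∀ k, (N k : ℚ_[p]) ≠ 0 := fun k => by exact_mod_cast h0 k
  choose e he heq using fun k =>
    exists_two_mul_sumInvSq_eq hp2 (hd k) (h0 k) _ _ _ _ rfl rfl rfl rfl
  have he0 : Tendsto (fun k => e k / (N k : ℚ_[p])) atTop (𝓝 0) := by
    refine squeeze_zero_norm (a := fun k => ‖(N k : ℚ_[p])‖) (fun k => ?_) (by simpa using hN.norm)
    rw [norm_div, div_le_iff₀ (norm_pos_iff.2 (hN0 k)), ← sq]
    exact he k
  have hg2 := dworkCoeff_two hp2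
  set g1 := dworkCoeff p 1
  set g2 := dworkCoeff p 2
  -- Since 4g₂ = 2g₁², the order-0 terms cancel and the identity can be divided by N. Here α and β
  -- are the first-order parts in g₁ - Nα and g₁ - Nβ, the quantities attached to N and 2N.
  have hα := tendsto_const_nhds (x := g2).sub (hN.mul hr)
  have hβ := (tendsto_const_nhds (x := g2).sub ((hN.const_mul 2).mul hr')).const_mul 2
  have ha := tendsto_const_nhds (x := g1).sub (hN.mul hα)
  have hX := he0.sub ((((hr.sub (hr'.const_mul 4)).const_mul 4).add
    (((hα.const_mul (12 * g1)).sub (hβ.const_mul (8 * g1))).add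
      (hN.mul (((hβ.pow 2).const_mul 4).sub ((hα.pow 2).const_mul 6))))).add
    (((ha.pow 3).const_mul 4).sub (hN.mul (ha.pow 4))))
  have hlim := hX.div ((hA.pow 4).const_mul 2) (by norm_num)
  refine Tendsto.congr' ?_ (hlim.trans_eq ?_)
  · filter_upwards [hA.eventually_ne one_ne_zero] with k hk
    have hk0 := hN0 k
    rw [Pi.div_apply, div_eq_iff (by simpa using hk), div_mul_eq_mul_div, heq k, hg2]
    field_simp
    ring
  · change 𝓝 ((0 - (4 * (dworkCoeff p 3 - 4 * dworkCoeff p 3) + _ + _)) / _) = _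
    congr 1
    rw [hg2]
    ring

/-! ### The Teichmüller character and Volkenborn sums -/

/-- Both terms have the same image under the residue map ℤ_p → 𝔽_p, so their difference is not a
unit. -/
theorem norm_natCast_sub_teichmullerChar_lt_one (n : ℕ) :
    ‖(n : ℤ_[p]) - teichmullerChar p (n : ZMod p)‖ < 1 := by
  rw [← PadicInt.mem_nonunits]
  intro h
  have h1 := h.map ((WittVector.constantCoeff (p := p) (R := ZMod p)).comp
    (WittVector.equiv p).symm.toRingHom)
  have h2 : (WittVector.equiv p).symm (teichmullerChar p (n : ZMod p)) =
      WittVector.teichmuller p (n : ZMod p) := (WittVector.equiv p).symm_apply_apply _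
  have h3 : WittVector.constantCoeff (WittVector.teichmuller p (n : ZMod p)) = (n : ZMod p) :=
    WittVector.teichmuller_coeff_zero p _
  rw [map_sub, map_natCast, RingHom.comp_apply, RingEquiv.toRingHom_eq_coe, RingHom.coe_coe, h2, h3,
    sub_self] at h1
  exact not_isUnit_zero h1

theorem inv_teichmullerChar_mul {n : ℕ} (hn : ¬ p ∣ n) :
    (teichmullerChar p)⁻¹ (n : ZMod p) * teichmullerChar p (n : ZMod p) = 1 := by
  have hu : IsUnit (n : ZMod p) := by
    rw [isUnit_iff_ne_zero, Ne, CharP.cast_eq_zero_iff (ZMod p) p]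
    exact hn
  rw [← MulChar.mul_apply, inv_mul_cancel, MulChar.one_apply hu]

theorem norm_angle_sub_one_lt_one {n : ℕ} (hn : ¬ p ∣ n) : ‖angle p n - 1‖ < 1 := by
  have e : angle p n - 1 = (teichmullerChar p)⁻¹ (n : ZMod p) *
      ((n : ℤ_[p]) - teichmullerChar p (n : ZMod p)) := by
    rw [angle, ← inv_teichmullerChar_mul hn]
    ring
  rw [e, norm_mul]
  exact (mul_le_of_le_one_left (norm_nonneg _) (PadicInt.norm_le_one _)).trans_lt
    (norm_natCast_sub_teichmullerChar_lt_one n)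

/-- The Mahler series is the continuous additive character of ℤ_p with value u at 1, so the
exponents -2 and 1 + 1 add up to 0. -/
theorem unitPow_neg_two_mul_sq {u : ℤ_[p]} (hu : ‖u - 1‖ < 1) : unitPow u (-2) * u ^ 2 = 1 := by
  have hr : Tendsto ((u - 1) ^ · : ℕ → ℤ_[p]) atTop (𝓝 0) :=
    tendsto_pow_atTop_nhds_zero_of_norm_lt_one hu
  have h1 : ∀ t, unitPow u t = PadicInt.addChar_of_value_at_one (u - 1) hr t := fun t => by
    rw [PadicInt.coe_addChar_of_value_at_one hr]
    rfl
  have h2 : PadicInt.addChar_of_value_at_one (u - 1) hr (1 : ℤ_[p]) = u := by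
    rw [PadicInt.addChar_of_value_at_one_def hr]
    ring
  rw [h1]
  nth_rewrite 2 [← h2]
  rw [sq, ← AddChar.map_add_eq_mul, ← AddChar.map_add_eq_mul,
    show (-2 + (1 + 1) : ℤ_[p]) = 0 by ring, AddChar.map_zero_eq_one]

theorem teichmullerChar_mul_unitPow {n : ℕ} (hn : ¬ p ∣ n) :
    (((teichmullerChar p ^ (-2 : ℤ)) (n : ZMod p) * unitPow (angle p n) (1 - 3) : ℤ_[p]) : ℚ_[p]) =
      ((n : ℚ_[p]) ^ 2)⁻¹ := by
  have hz : (teichmullerChar p ^ (-2 : ℤ)) (n : ZMod p) =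
      (teichmullerChar p)⁻¹ (n : ZMod p) ^ 2 := by
    rw [show (-2 : ℤ) = -((2 : ℕ) : ℤ) by norm_num, zpow_neg, zpow_natCast, ← inv_pow,
      MulChar.pow_apply' _ two_ne_zero]
  have hu := unitPow_neg_two_mul_sq (norm_angle_sub_one_lt_one hn)
  have key : (teichmullerChar p ^ (-2 : ℤ)) (n : ZMod p) * unitPow (angle p n) (1 - 3) *
      (n : ℤ_[p]) ^ 2 = 1 := by
    rw [hz, show (1 - 3 : ℤ_[p]) = -2 by norm_num, ← hu]
    nth_rewrite 3 [angle]
    ring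
  refine eq_inv_of_mul_eq_one_left ?_
  exact_mod_cast congrArg (fun z : ℤ_[p] => (z : ℚ_[p])) key

theorem volkenbornSum_three (k : ℕ) :
    volkenbornSum p 3 (teichmullerChar p ^ (-2 : ℤ)) k =
      sumInvSq p (p ^ (k + 1)) / ((p ^ (k + 1) : ℕ) : ℚ_[p]) := by
  -- The two ranges differ only in the endpoints 0 and p^(k+1), both divisible by p.
  have hs : (Finset.Icc 1 (p ^ (k + 1))).filter (fun n => ¬ p ∣ n) =
      unitsBelow p (p ^ (k + 1)) := by
    ext n
    simp only [unitsBelow, Finset.mem_filter, Finset.mem_Icc, Finset.mem_range]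
    constructor
    · rintro ⟨⟨_, h2⟩, h3⟩
      refine ⟨lt_of_le_of_ne h2 ?_, h3⟩
      rintro rfl
      exact h3 (dvd_pow_self p k.succ_ne_zero)
    · rintro ⟨h2, h3⟩
      refine ⟨⟨Nat.pos_of_ne_zero ?_, h2.le⟩, h3⟩
      rintro rfl
      exact h3 (dvd_zero p)
  rw [volkenbornSum, hs, div_eq_inv_mul, Nat.cast_pow, sumInvSq]
  congr 1
  exact Finset.sum_congr rfl fun n hn =>
    teichmullerChar_mul_unitPow (not_dvd_of_mem_unitsBelow hn)

theorem borel_DxPowDwork (s : ℕ) : borel (DxPowDwork p s) = tailSum^[s] (dworkSeq p) := by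
  rw [DxPowDwork, borel_iterate_Dx, borel_dworkExp]

theorem constTerm_DxPowDwork (s : ℕ) : constTerm (DxPowDwork p s) = dworkCoeff p s := by
  rw [dworkCoeff, ← borel_DxPowDwork]
  simp [borel, constTerm]

theorem Delta_three : Delta p 3 = dworkCoeff p 3 - dworkCoeff p 1 ^ 3 / 6 := by
  rw [Delta, constTerm_DxPowDwork, constTerm_DxPowDwork]
  norm_num [Nat.factorial]

theorem tendsto_volkenbornSum_three (hp2 : p ≠ 2) :
    Tendsto (volkenbornSum p 3 (teichmullerChar p ^ (-2 : ℤ))) atTop (𝓝 (6 * Delta p 3)) := by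
  rw [Delta_three]
  refine (tendsto_sumInvSq_div hp2 (fun k => dvd_pow_self p k.succ_ne_zero)
    (fun k => pow_ne_zero _ (Fact.out : p.Prime).ne_zero) tendsto_natCast_pow_succ).congr
    fun k => (volkenbornSum_three k).symm

theorem kubotaLeopoldt_three (hp2 : p ≠ 2) :
    kubotaLeopoldt p 3 (teichmullerChar p ^ (-2 : ℤ)) = 3 * Delta p 3 := by
  rw [kubotaLeopoldt, (tendsto_volkenbornSum_three hp2).limUnder_eq]
  have h : (((3 : ℤ_[p]) : ℚ_[p]) - 1) = 2 := by
    rw [show ((3 : ℤ_[p]) : ℚ_[p]) = 3 from PadicInt.coe_natCast 3]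
    norm_num
  rw [h]
  ring

theorem padicZeta_three : padicZeta p 3 =
    (p : ℚ_[p]) ^ 3 / ((p : ℚ_[p]) ^ 3 - 1) *
      kubotaLeopoldt p 3 (teichmullerChar p ^ (-2 : ℤ)) := by
  rw [padicZeta]
  norm_num

end DworkGamma

/-- Evaluation of `Δ₃`. The first two conjuncts say that the infinite sums defining `D_x^s f` and
the limit defining `L_p(3, ω⁻²)` converge. -/
theorem mainTheorem1 (p : ℕ) [Fact p.Prime] (hp : p ≠ 2) :
    (∀ (s : ℕ) (n : ℤ), Summable fun i : ℕ =>
      (DworkGamma.pderiv^[i] (DworkGamma.divX (DworkGamma.DxPowDwork p s))) n) ∧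
    (∃ l : ℚ_[p], Filter.Tendsto
      (DworkGamma.volkenbornSum p 3 (DworkGamma.teichmullerChar p ^ (-2 : ℤ)))
      Filter.atTop (nhds l)) ∧
    DworkGamma.Delta p 3 =
      DworkGamma.kubotaLeopoldt p 3 (DworkGamma.teichmullerChar p ^ (-2 : ℤ)) / 3 ∧
    DworkGamma.Delta p 3 = (1 - 1 / (p : ℚ_[p]) ^ 3) * (DworkGamma.padicZeta p 3 / 3) ∧
    (p : ℚ_[p]) ^ 3 * (24 / 25) * DworkGamma.Delta p 3 =
      (p : ℚ_[p]) ^ 3 * (2 ^ 3 / 5 ^ 2) *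
        DworkGamma.kubotaLeopoldt p 3 (DworkGamma.teichmullerChar p ^ (-2 : ℤ)) ∧
    (p : ℚ_[p]) ^ 3 * (24 / 25) * DworkGamma.Delta p 3 =
      ((p : ℚ_[p]) ^ 3 - 1) * (2 ^ 3 / 5 ^ 2) * DworkGamma.padicZeta p 3 := by
  have hL := DworkGamma.kubotaLeopoldt_three hp
  have hp0 : (p : ℚ_[p]) ^ 3 ≠ 0 := pow_ne_zero 3 (by exact_mod_cast (Fact.out : p.Prime).ne_zero)
  have hp1 : (p : ℚ_[p]) ^ 3 - 1 ≠ 0 := by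
    have h : p ^ 3 ≠ 1 := (Nat.one_lt_pow three_ne_zero (Fact.out : p.Prime).one_lt).ne'
    exact sub_ne_zero.2 (by exact_mod_cast h)
  refine ⟨fun s n => ?_, ⟨_, DworkGamma.tendsto_volkenbornSum_three hp⟩, ?_, ?_, ?_, ?_⟩
  · refine DworkGamma.Rapid.summable_iterate_pderiv ?_ n
    rw [DworkGamma.borel_DxPowDwork]
    exact DworkGamma.rapid_dworkSeq.iterate_tailSum s
  · rw [hL]
    ring
  · rw [DworkGamma.padicZeta_three, hL]
    generalize (p : ℚ_[p]) ^ 3 = q at hp0 hp1 ⊢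
    field_simp
  · rw [hL]
    ring
  · rw [DworkGamma.padicZeta_three, hL]
    field_simp
    ring
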